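/- Let $\Bbbk$ be an algebraically closed field of characteristic $0$ and let $A$ be a Poisson Hopf algebra over $\Bbbk$: a commutative Hopf $\Bbbk$-algebra with a $\Bbbk$-bilinear bracket $\{-,-\}$ that makes $A$ a Lie algebra, satisfies $\{ab,c\}=a\{b,c\}+\{a,c\}b$, and for which $\Delta(\{a,b\})=\{\Delta(a),\Delta(b)\}$, where $A\otimes A$ carries the bracket $\{a\otimes b,c\otimes d\}=\{a,c\}\otimes bd+ac\otimes\{b,d\}$. Suppose that $A$ is finitely generated as an algebra and has an algebra grading $A=\bigoplus_{i\ge 0}A(i)$ (no compatibility with the coalgebra structure is assumed) such that $A(0)=\Bbbk$ and, for some integer $d\ge 0$, $\{A(i),A(j)\}\subseteq A(i+j+d)$ for all $i,j\ge 0$. Then, as an algebra, $A$ is a polynomial algebra in finitely many variables, and $A$ is unimodular: for every choice of polynomial generators, $A=\Bbbk[x_1,\dots,x_n]$, the modular derivation $$\delta(f)=\sum_{j=1}^n\frac{\partial\{f,x_j\}}{\partial x_j}\qquad(f\in A)$$ is zero. (In particular $\delta$ is log-Hamiltonian, that is, of the form $u^{-1}\{u,-\}$ for a unit $u$ of $A$,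 which is the general definition of unimodularity.) -/

import Mathlib

open scoped TensorProduct

/-- A Poisson algebra structure on a commutative algebra `A` over `k`: a `k`-bilinear bracket that
makes `A` a Lie algebra and satisfies the Leibniz rule. -/
class PoissonAlgebra (k A : Type*) [Field k] [CommRing A] [Algebra k A] where
  /-- The Poisson bracket. -/
  bracket : A →ₗ[k] A →ₗ[k] A
  bracket_self : ∀ a : A, bracket a a = 0
  jacobi : ∀ a b c : A,
    bracket a (bracket b c) + bracket b (bracket c a) + bracket c (bracket a b) = 0
  leibniz : ∀ a b c : A, bracket (a * b) c = a * bracket b c + bracket a c * b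

namespace PoissonAlgebra

section Tensor

variable (k A B : Type*) [Field k] [CommRing A] [Algebra k A] [PoissonAlgebra k A]
  [CommRing B] [Algebra k B] [PoissonAlgebra k B]

/-- The Poisson bracket of the tensor product of two Poisson algebras,
`{a ⊗ b, c ⊗ d} = {a, c} ⊗ bd + ac ⊗ {b, d}`. -/
noncomputable def tensorBracket : (A ⊗[k] B) →ₗ[k] (A ⊗[k] B) →ₗ[k] (A ⊗[k] B) :=
  TensorProduct.map₂ (bracket (k := k) (A := A)) (LinearMap.mul k B) +
    TensorProduct.map₂ (LinearMap.mul k A) (bracket (k := k) (A := B))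

theorem tensorBracket_tmul (a c : A) (b d : B) :
    tensorBracket k A B (a ⊗ₜ[k] b) (c ⊗ₜ[k] d) =
      bracket (k := k) a c ⊗ₜ[k] (b * d) + (a * c) ⊗ₜ[k] bracket (k := k) b d := by
  simp [tensorBracket]

end Tensor

section Grading

variable {k A : Type*} [Field k] [CommRing A] [Algebra k A]

/-- An `ℕ`-grading is connected if its degree zero part is `k = k · 1`. -/
def IsConnectedGrading (𝒜 : ℕ → Submodule k A) : Prop :=
  𝒜 0 = Submodule.span k {(1 : A)}

/-- The Poisson bracket is homogeneous of degree `d ≥ 0`: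
`{A(i), A(j)} ⊆ A(i + j + d)`. -/
def IsHomogeneousBracket [PoissonAlgebra k A] (𝒜 : ℕ → Submodule k A) (d : ℕ) : Prop :=
  ∀ i j : ℕ, ∀ a ∈ 𝒜 i, ∀ b ∈ 𝒜 j, bracket (k := k) a b ∈ 𝒜 (i + j + d)

end Grading

section Modular

variable {k A : Type*} [Field k] [CommRing A] [Algebra k A]

/-- The partial derivative `∂ / ∂ x_j` on `A`, in the polynomial coordinates
`x_j = e.symm (X j)` given by an isomorphism `e : A ≃ k[X_1, …, X_n]`. -/
noncomputable def coordDeriv {n : ℕ} (e : A ≃ₐ[k] MvPolynomial (Fin n) k) (j : Fin n) :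
    A →ₗ[k] A :=
  e.symm.toLinearMap ∘ₗ (MvPolynomial.pderiv j).toLinearMap ∘ₗ e.toLinearMap

variable [PoissonAlgebra k A]

/-- The modular derivation `δ(f) = ∑_j ∂{f, x_j} / ∂x_j` of a Poisson polynomial algebra
with respect to the volume form `dx_1 ∧ ⋯ ∧ dx_n`. -/
noncomputable def modularDerivation {n : ℕ} (e : A ≃ₐ[k] MvPolynomial (Fin n) k) : A →ₗ[k] A :=
  ∑ j : Fin n, coordDeriv e j ∘ₗ (bracket (k := k) (A := A)).flip (e.symm (MvPolynomial.X j))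

/-- A map is log-Hamiltonian if it is `u⁻¹ {u, -}` for a unit `u` of `A`. -/
def IsLogHamiltonian (δ : A →ₗ[k] A) : Prop :=
  ∃ u : Aˣ, ∀ f : A, δ f = (↑u⁻¹ : A) * bracket (k := k) (u : A) f

variable (k A) in
/-- A Poisson algebra `A` is a unimodular polynomial Poisson algebra: as an algebra it is a
polynomial algebra of finite rank, and its modular class is trivial, that is, its modular
derivation, in whatever coordinates, is log-Hamiltonian. -/
def IsUnimodularPolynomial : Prop :=
  (∃ n : ℕ, Nonempty (A ≃ₐ[k] MvPolynomial (Fin n) k)) ∧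
    ∀ (n : ℕ) (e : A ≃ₐ[k] MvPolynomial (Fin n) k), IsLogHamiltonian (modularDerivation e)

end Modular

end PoissonAlgebra

/-- A commutative Hopf algebra that is a Poisson algebra is a Poisson Hopf algebra if its
comultiplication `Δ : A → A ⊗ A` is a Poisson morphism. -/
class IsPoissonHopfAlgebra (k A : Type*) [Field k] [CommRing A] [HopfAlgebra k A]
    [PoissonAlgebra k A] : Prop where
  comul_bracket : ∀ a b : A,
    CoalgebraStruct.comul (R := k) (PoissonAlgebra.bracket (k := k) a b) =
      PoissonAlgebra.tensorBracket k A A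
        (CoalgebraStruct.comul (R := k) a) (CoalgebraStruct.comul (R := k) b)

/-!
Let `G` be the affine group with coordinate ring `A`, and let `χ : A → k` be the character that
takes the degree zero part: a point of `G`, the origin of the grading, in general different from the
unit `ε`.

*`A` is polynomial.* Choose homogeneous elements `x_i` of `A` whose differentials form a basis of the
cotangent space at `χ`. They generate `A` by graded Nakayama (`adjoin_eq_top_of_span_sup_sq`). Since
`G` is a group, each dual tangent vector at `χ` extends to a derivation of `A`
(`IsPointDerivation.exists_derivation`), and the matrix formed by these derivations of the `x_j` has
determinant nonzero at `χ`, hence a nonzerodivisor. So the ideal of relations between the `x_i` is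
stable under all partial derivatives, and in characteristic zero it vanishes
(`aeval_injective_of_dual`).

*The modular derivation of a Poisson group.* Compute the divergence `δ f` of `{f, -}` with the
left-invariant frame instead of the coordinate frame. This gives the same result, because the two
volume forms differ by a unit, and units of a polynomial algebra are constants
(`trace_mul_map_derivation_eq_zero`, `sum_invariantFrame_eq_divergence`). As `Δ` is a Poisson
morphism, the outcome, with `c = ε ∘ δ`, is `δ f = f₁ c(f₂) + S(f₂){f₁, f₃}`
(`modularDerivation_eq_sum`). The same formula for the co-opposite Hopf algebra reads
`δ f = c(f₁) f₂ - S(f₂){f₁, f₃}`, and the sum of both is `2 δ f = f₁ c(f₂) + c(f₁) f₂`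
(`two_mul_modularDerivation`). Hence `δ = 0` as soon as `c = 0`.

*The grading.* Since `{A(i), A(j)} ⊆ A(i + j + d)` and constants are central, brackets vanish at `χ`
(`character_bracket_eq_zero`), and `{f, -}` strictly raises degrees. So it has trace zero on the
cotangent space at `χ`; this trace is `χ (δ f)` (`character_modularDerivation_eq_zero`). Applying `χ`
to the left-invariant formula leaves `χ * c = 0` for the convolution product, and `χ` is invertible
for this product. Thus `c = 0` (`modularDerivation_eq_zero_of_character`).
-/

open Coalgebra HopfAlgebra WithConv PoissonAlgebra DirectSum

/-! ### Convolution of linear endomorphisms -/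

section Convolution

variable {k A : Type*} [Field k] [CommRing A] [HopfAlgebra k A]

/-- The convolution product `a ↦ ∑ f a₍₁₎ * g a₍₂₎` of linear endomorphisms of `A`. -/
noncomputable def conv (f g : A →ₗ[k] A) : A →ₗ[k] A := (toConv f * toConv g).ofConv

local infixl:70 " ⋆ " => conv

/-- A functional `w : A → k`, regarded as an endomorphism `A → k ⊆ A`. -/
noncomputable def scalarMap (w : A →ₗ[k] k) : A →ₗ[k] A := Algebra.linearMap k A ∘ₗ w

theorem scalarMap_apply (w : A →ₗ[k] k) (a : A) : scalarMap w a = algebraMap k A (w a) := rfl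

theorem conv_apply {ι : Type*} {a : A} (r : Coalgebra.Repr k a ι) (f g : A →ₗ[k] A) :
    (f ⋆ g) a = ∑ i ∈ r.index, f (r.left i) * g (r.right i) :=
  r.convMul_apply (toConv f) (toConv g)

theorem conv_assoc (f g h : A →ₗ[k] A) : f ⋆ g ⋆ h = f ⋆ (g ⋆ h) :=
  congrArg WithConv.ofConv (mul_assoc (toConv f) (toConv g) (toConv h))

theorem scalarMap_counit_conv (f : A →ₗ[k] A) : scalarMap counit ⋆ f = f :=
  congrArg WithConv.ofConv (one_mul (toConv f))

theorem conv_scalarMap_counit (f : A →ₗ[k] A) : f ⋆ scalarMap counit = f :=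
  congrArg WithConv.ofConv (mul_one (toConv f))

theorem antipode_conv_id : antipode k ⋆ LinearMap.id = scalarMap (counit : A →ₗ[k] k) :=
  congrArg WithConv.ofConv (LinearMap.antipode_mul_id (R := k) (C := A))

theorem conv_add (f g h : A →ₗ[k] A) : f ⋆ (g + h) = f ⋆ g + f ⋆ h :=
  congrArg WithConv.ofConv (mul_add (toConv f) (toConv g) (toConv h))

theorem conv_smul (f g : A →ₗ[k] A) (a : A) : f ⋆ (a • g) = a • (f ⋆ g) := by
  ext x
  simp only [conv_apply (ℛ k x), LinearMap.smul_apply, smul_eq_mul, Finset.mul_sum]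
  exact Finset.sum_congr rfl fun i _ => by ring

theorem conv_zero (f : A →ₗ[k] A) : f ⋆ 0 = 0 :=
  congrArg WithConv.ofConv (mul_zero (toConv f))

theorem conv_sum {ι : Type*} (s : Finset ι) (f : A →ₗ[k] A) (g : ι → A →ₗ[k] A) :
    f ⋆ (∑ i ∈ s, g i) = ∑ i ∈ s, f ⋆ g i := by
  classical
  induction s using Finset.induction_on with
  | empty => simp [conv_zero]
  | insert i s hi ih => simp [Finset.sum_insert hi, conv_add, ih]

theorem derivation_comp_conv (X : Derivation k A A) (f g : A →ₗ[k] A) :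
    (X : A →ₗ[k] A) ∘ₗ (f ⋆ g) = ((X : A →ₗ[k] A) ∘ₗ f) ⋆ g + f ⋆ ((X : A →ₗ[k] A) ∘ₗ g) := by
  ext x
  simp only [conv_apply (ℛ k x), LinearMap.comp_apply, LinearMap.add_apply, map_sum,
    Derivation.coeFn_coe, Derivation.leibniz, smul_eq_mul, ← Finset.sum_add_distrib]
  exact Finset.sum_congr rfl fun i _ => by ring

theorem derivation_comp_scalarMap (X : Derivation k A A) (w : A →ₗ[k] k) :
    (X : A →ₗ[k] A) ∘ₗ scalarMap w = 0 := by
  ext x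
  simp [scalarMap_apply]

/-- Convolving an algebra homomorphism `q` with a derivation along `p` gives a derivation along
`q ⋆ p`. -/
theorem conv_leibniz (q p : A →ₐ[k] A) (u : A →ₗ[k] A)
    (hu : ∀ a b, u (a * b) = p a * u b + p b * u a) (a b : A) :
    (q.toLinearMap ⋆ u) (a * b) =
      (q.toLinearMap ⋆ p.toLinearMap) a * (q.toLinearMap ⋆ u) b +
        (q.toLinearMap ⋆ p.toLinearMap) b * (q.toLinearMap ⋆ u) a := by
  simp only [conv_apply ((ℛ k a).mul (ℛ k b)), conv_apply (ℛ k a), conv_apply (ℛ k b)]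
  rw [mul_comm (∑ i ∈ (ℛ k b).index, q.toLinearMap ((ℛ k b).left i) *
    p.toLinearMap ((ℛ k b).right i))]
  simp only [Finset.sum_mul_sum, ← Finset.sum_product', ← Finset.sum_add_distrib]
  refine Finset.sum_congr rfl fun i _ => ?_
  simp [hu]
  ring

end Convolution

/-! ### The logarithmic derivative of a determinant -/

/-- Jacobi's formula `X (det N) = det N * tr (N⁻¹ X(N))`, in the case where `det N` is killed
by `X`. -/
theorem trace_mul_map_derivation_eq_zero {k A ι : Type*} [CommRing k] [CommRing A] [Algebra k A]
    [Fintype ι] [DecidableEq ι] (X : Derivation k A A) (M N : Matrix ι ι A) (h : M * N = 1)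
    (hdet : X N.det = 0) : (M * N.map X).trace = 0 := by
  -- `φ = 1 + εX` is a ring homomorphism to the dual numbers, so it commutes with determinants.
  let φ : A →+* DualNumber A :=
    { toFun := fun a => TrivSqZeroExt.inl a + TrivSqZeroExt.inr (X a)
      map_one' := by simp
      map_mul' := fun a b => by ext <;> simp [mul_comm]
      map_zero' := by simp
      map_add' := fun a b => by ext <;> simp }
  have hφ : N.map φ = N.map (TrivSqZeroExt.inlHom A A) *
      (1 + (DualNumber.eps : DualNumber A) • (M * N.map X).map (TrivSqZeroExt.inlHom A A)) := by
    have hNM : N * M = 1 := mul_eq_one_comm.mp h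
    rw [mul_add, mul_one, Matrix.mul_smul, ← Matrix.map_mul, ← mul_assoc, hNM, one_mul]
    refine Matrix.ext fun i j => ?_
    change TrivSqZeroExt.inl (N i j) + TrivSqZeroExt.inr (X (N i j)) =
      TrivSqZeroExt.inl (N i j) + TrivSqZeroExt.inr 1 * TrivSqZeroExt.inl (X (N i j))
    ext <;> simp
  have h1 := congrArg Matrix.det hφ
  rw [Matrix.det_mul, Matrix.det_one_add_smul] at h1
  have h2 : (N.map φ).det = φ N.det := (RingHom.map_det φ N).symm
  have h3 : (N.map (TrivSqZeroExt.inlHom A A)).det = TrivSqZeroExt.inlHom A A N.det :=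
    (RingHom.map_det _ N).symm
  have h4 : ((M * N.map X).map (TrivSqZeroExt.inlHom A A)).trace =
      TrivSqZeroExt.inl (M * N.map X).trace := by
    exact (map_sum (TrivSqZeroExt.inlHom A A) (fun i => (M * N.map X) i i) _).symm
  rw [h2, h3, h4] at h1
  have h5 := congrArg TrivSqZeroExt.snd h1
  have h6 : (DualNumber.eps : DualNumber A) ^ 2 = 0 := by
    rw [pow_two]; exact DualNumber.eps_mul_eps
  rw [h6] at h5
  simp [φ, hdet] at h5
  have hu : M.det * N.det = 1 := by rw [← Matrix.det_mul, h, Matrix.det_one]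
  calc (M * N.map X).trace = M.det * N.det * (M * N.map X).trace := by rw [hu, one_mul]
    _ = M.det * (N.det * (M * N.map X).trace) := by ring
    _ = 0 := by rw [← h5, mul_zero]

/-! ### Polynomial coordinates and Hamiltonian derivations -/

section Coordinates

variable {k A : Type*} [Field k] [CommRing A] [Algebra k A] {n : ℕ}

/-- The partial derivative `∂ / ∂ x_j` of `coordDeriv`, as a derivation. -/
noncomputable def coordDerivation (e : A ≃ₐ[k] MvPolynomial (Fin n) k) (j : Fin n) :
    Derivation k A A :=
  Derivation.mk' (coordDeriv e j) fun a b => by simp [coordDeriv]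

theorem coordDerivation_apply (e : A ≃ₐ[k] MvPolynomial (Fin n) k) (j : Fin n) (a : A) :
    coordDerivation e j a = e.symm (MvPolynomial.pderiv j (e a)) := rfl

theorem coordDerivation_coord (e : A ≃ₐ[k] MvPolynomial (Fin n) k) (i j : Fin n) :
    coordDerivation e i (e.symm (MvPolynomial.X j)) = if i = j then 1 else 0 := by
  classical
  rw [coordDerivation_apply, AlgEquiv.apply_symm_apply, MvPolynomial.pderiv_X, Pi.single_apply]
  split_ifs <;> simp_all

theorem adjoin_range_coord (e : A ≃ₐ[k] MvPolynomial (Fin n) k) :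
    Algebra.adjoin k (Set.range fun j => e.symm (MvPolynomial.X j)) = ⊤ := by
  have h : (Set.range fun j => e.symm (MvPolynomial.X j)) =
      (e.symm : MvPolynomial (Fin n) k →ₐ[k] A) '' Set.range MvPolynomial.X := by
    rw [← Set.range_comp]; rfl
  rw [h, ← AlgHom.map_adjoin, MvPolynomial.adjoin_range_X, Algebra.map_top]
  exact (AlgHom.range_eq_top _).2 e.symm.surjective

theorem derivation_sum_apply {ι : Type*} (s : Finset ι) (D : ι → Derivation k A A) (a : A) :
    (∑ i ∈ s, D i) a = ∑ i ∈ s, D i a := by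
  rw [← Derivation.coeFnAddMonoidHom_apply, map_sum, Finset.sum_apply]
  rfl

/-- A derivation with values in `A` is the combination `∑_j D(x_j) ∂/∂x_j` of the partial
derivatives. -/
theorem derivation_eq_sum_coord (e : A ≃ₐ[k] MvPolynomial (Fin n) k) (D : Derivation k A A) :
    D = ∑ j, D (e.symm (MvPolynomial.X j)) • coordDerivation e j := by
  refine Derivation.ext_of_adjoin_eq_top _ (adjoin_range_coord e) ?_
  rintro _ ⟨i, rfl⟩
  have hc : ∀ j : Fin n, (D (e.symm (MvPolynomial.X j)) • coordDerivation e j)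
      (e.symm (MvPolynomial.X i)) = if j = i then D (e.symm (MvPolynomial.X j)) else 0 := by
    intro j
    rw [Derivation.smul_apply, coordDerivation_coord, smul_eq_mul, mul_ite, mul_one, mul_zero]
  rw [derivation_sum_apply]
  simp [hc]

theorem coe_derivation_eq_sum_coord (e : A ≃ₐ[k] MvPolynomial (Fin n) k) (D : Derivation k A A) :
    (D : A →ₗ[k] A) = ∑ j, D (e.symm (MvPolynomial.X j)) • coordDeriv e j := by
  ext a
  have h := congrArg (fun D' : Derivation k A A => D' a) (derivation_eq_sum_coord e D)
  rw [Derivation.coeFn_coe, LinearMap.sum_apply]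
  exact h.trans (derivation_sum_apply _ _ _)

/-- Units of a polynomial algebra over a field are constants, hence killed by derivations. -/
theorem derivation_unit_eq_zero (e : A ≃ₐ[k] MvPolynomial (Fin n) k) (D : Derivation k A A)
    {u : A} (hu : IsUnit u) : D u = 0 := by
  obtain ⟨r, -, hr⟩ := MvPolynomial.isUnit_iff_eq_C_of_isReduced.1 (hu.map e)
  have h : u = algebraMap k A r := by
    rw [← e.symm_apply_apply u, hr, ← MvPolynomial.algebraMap_eq, AlgEquiv.commutes]
  rw [h, Derivation.map_algebraMap]

variable [PoissonAlgebra k A]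

theorem bracket_comm (a b : A) : bracket (k := k) b a = -bracket (k := k) a b := by
  have h := bracket_self (k := k) (a + b)
  simp only [map_add, LinearMap.add_apply, bracket_self, zero_add, add_zero] at h
  exact eq_neg_of_add_eq_zero_left h

/-- The Hamiltonian derivation `{f, -}`. -/
noncomputable def hamiltonian (f : A) : Derivation k A A :=
  Derivation.mk' (bracket (k := k) f) fun a b => by
    rw [bracket_comm (a * b) f, leibniz, bracket_comm f b, bracket_comm f a]
    simp only [smul_eq_mul]
    ring

theorem coe_hamiltonian (f : A) :
    (hamiltonian (k := k) f : A →ₗ[k] A) = bracket (k := k) f := rfl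

theorem hamiltonian_apply (f a : A) : hamiltonian (k := k) f a = bracket (k := k) f a := rfl

theorem modularDerivation_apply (e : A ≃ₐ[k] MvPolynomial (Fin n) k) (f : A) :
    modularDerivation e f =
      ∑ j, coordDeriv e j (bracket (k := k) f (e.symm (MvPolynomial.X j))) := by
  simp [modularDerivation]

end Coordinates

/-! ### The modular derivation in a left-invariant frame -/

section Frame

variable {k A : Type*} [Field k] [CommRing A] [HopfAlgebra k A] {n : ℕ}

local infixl:70 " ⋆ " => conv

/-- The tangent vector `∂ / ∂ x_j` at the unit element, a point derivation `A → k` at `ε`. -/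
noncomputable def unitTangent (e : A ≃ₐ[k] MvPolynomial (Fin n) k) (j : Fin n) : A →ₗ[k] k :=
  counit ∘ₗ coordDeriv e j

theorem unitTangent_mul (e : A ≃ₐ[k] MvPolynomial (Fin n) k) (j : Fin n) (a b : A) :
    unitTangent e j (a * b) = counit a * unitTangent e j b + counit b * unitTangent e j a := by
  change counit (coordDerivation e j (a * b)) = _
  rw [Derivation.leibniz]
  simp [unitTangent, coordDerivation_apply, coordDeriv]

theorem unitTangent_coord (e : A ≃ₐ[k] MvPolynomial (Fin n) k) (i j : Fin n) :
    unitTangent e i (e.symm (MvPolynomial.X j)) = if i = j then 1 else 0 := by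
  change counit (coordDerivation e i _) = _
  rw [coordDerivation_coord]
  split_ifs <;> simp

/-- The left-invariant derivation `a ↦ ∑ a₍₁₎ ∂_j(a₍₂₎)(1)` that extends `unitTangent`. -/
noncomputable def invariantFrame (e : A ≃ₐ[k] MvPolynomial (Fin n) k) (j : Fin n) :
    Derivation k A A :=
  Derivation.mk' (LinearMap.id ⋆ scalarMap (unitTangent e j)) fun a b => by
    have h := conv_leibniz (AlgHom.id k A) ((Algebra.ofId k A).comp (Bialgebra.counitAlgHom k A))
      (scalarMap (unitTangent e j)) (fun a b => by
        simp [scalarMap_apply, unitTangent_mul, Algebra.ofId_apply]) a b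
    have h1 : (AlgHom.id k A).toLinearMap ⋆
        ((Algebra.ofId k A).comp (Bialgebra.counitAlgHom k A)).toLinearMap = LinearMap.id :=
      conv_scalarMap_counit LinearMap.id
    rw [h1] at h
    exact h

theorem coe_invariantFrame (e : A ≃ₐ[k] MvPolynomial (Fin n) k) (j : Fin n) :
    (invariantFrame e j : A →ₗ[k] A) = LinearMap.id ⋆ scalarMap (unitTangent e j) := rfl

theorem antipode_conv_invariantFrame (e : A ≃ₐ[k] MvPolynomial (Fin n) k) (j : Fin n) :
    antipode k ⋆ (invariantFrame e j : A →ₗ[k] A) = scalarMap (unitTangent e j) := by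
  rw [coe_invariantFrame, ← conv_assoc, antipode_conv_id, scalarMap_counit_conv]

/-- The matrix `(D_j x_i)` that expresses the left-invariant frame in coordinate fields. -/
noncomputable def frameMatrix (e : A ≃ₐ[k] MvPolynomial (Fin n) k) : Matrix (Fin n) (Fin n) A :=
  .of fun j i => invariantFrame e j (e.symm (MvPolynomial.X i))

/-- The matrix whose `j`-th column holds the coefficients `∑ S(a₍₁₎) ∂_i(a₍₂₎)`, for `a = x_j`, of
the left-invariant differential form `∑ S(a₍₁₎) da₍₂₎`. -/
noncomputable def coframeMatrix (e : A ≃ₐ[k] MvPolynomial (Fin n) k) : Matrix (Fin n) (Fin n) A :=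
  .of fun i j => (antipode k ⋆ coordDeriv e i) (e.symm (MvPolynomial.X j))

theorem invariantFrame_eq_sum (e : A ≃ₐ[k] MvPolynomial (Fin n) k) (j : Fin n) :
    (invariantFrame e j : A →ₗ[k] A) = ∑ i, frameMatrix e j i • coordDeriv e i :=
  coe_derivation_eq_sum_coord e _

theorem frameMatrix_mul_coframeMatrix (e : A ≃ₐ[k] MvPolynomial (Fin n) k) :
    frameMatrix e * coframeMatrix e = 1 := by
  refine Matrix.ext fun i j => ?_
  have h := congrArg (fun g : A →ₗ[k] A => g (e.symm (MvPolynomial.X j)))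
    (antipode_conv_invariantFrame e i)
  simp only [invariantFrame_eq_sum, conv_sum, conv_smul, LinearMap.sum_apply,
    LinearMap.smul_apply, scalarMap_apply, unitTangent_coord, smul_eq_mul] at h
  rw [Matrix.mul_apply, Matrix.one_apply]
  refine h.trans ?_
  split_ifs <;> simp

theorem coframeMatrix_mul_frameMatrix (e : A ≃ₐ[k] MvPolynomial (Fin n) k) :
    coframeMatrix e * frameMatrix e = 1 :=
  mul_eq_one_comm.mp (frameMatrix_mul_coframeMatrix e)

theorem coordDeriv_eq_sum (e : A ≃ₐ[k] MvPolynomial (Fin n) k) (i : Fin n) :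
    coordDeriv e i = ∑ j, coframeMatrix e i j • (invariantFrame e j : A →ₗ[k] A) := by
  simp only [invariantFrame_eq_sum, Finset.smul_sum, smul_smul]
  rw [Finset.sum_comm]
  simp only [← Finset.sum_smul, ← Matrix.mul_apply, coframeMatrix_mul_frameMatrix,
    Matrix.one_apply]
  simp

/-- `S ⋆ X` is a point derivation at the unit with values in `A`, so it is determined by its values
on the coordinates. -/
theorem antipode_conv_derivation (e : A ≃ₐ[k] MvPolynomial (Fin n) k) (X : Derivation k A A)
    (a : A) :
    (antipode k ⋆ (X : A →ₗ[k] A)) a =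
      ∑ j, (antipode k ⋆ (X : A →ₗ[k] A)) (e.symm (MvPolynomial.X j)) *
        algebraMap k A (unitTangent e j a) := by
  obtain ⟨c, hc⟩ : ∃ c : Fin n → A,
      (X : A →ₗ[k] A) = ∑ j, c j • (invariantFrame e j : A →ₗ[k] A) := by
    refine ⟨fun j => ∑ i, X (e.symm (MvPolynomial.X i)) * coframeMatrix e i j, ?_⟩
    rw [coe_derivation_eq_sum_coord e X]
    simp only [coordDeriv_eq_sum, Finset.smul_sum, smul_smul, Finset.sum_smul]
    exact Finset.sum_comm
  have h : ∀ a, (antipode k ⋆ (X : A →ₗ[k] A)) a =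
      ∑ j, c j * algebraMap k A (unitTangent e j a) := by
    intro a
    simp only [hc, conv_sum, conv_smul, antipode_conv_invariantFrame, LinearMap.sum_apply,
      LinearMap.smul_apply, scalarMap_apply, smul_eq_mul]
  have hX : ∀ j, (antipode k ⋆ (X : A →ₗ[k] A)) (e.symm (MvPolynomial.X j)) = c j := by
    intro j
    simp [h, unitTangent_coord]
  simp only [hX]
  exact h a

/-- The trace of the Lie derivative along `X`, computed in the left-invariant frame, is the
divergence of `X` in the coordinates: the two volume forms differ by a unit, that is, by a
constant. -/
theorem sum_invariantFrame_eq_divergence (e : A ≃ₐ[k] MvPolynomial (Fin n) k)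
    (X : Derivation k A A) :
    ∑ j, (((X : A →ₗ[k] A) ∘ₗ antipode k) ⋆ (invariantFrame e j : A →ₗ[k] A) +
        antipode k ⋆ ((invariantFrame e j : A →ₗ[k] A) ∘ₗ (X : A →ₗ[k] A)))
          (e.symm (MvPolynomial.X j)) =
      ∑ j, coordDeriv e j (X (e.symm (MvPolynomial.X j))) := by
  set x : Fin n → A := fun j => e.symm (MvPolynomial.X j) with hx
  have hcomm : ∀ i, coordDeriv e i ∘ₗ (X : A →ₗ[k] A) =
      (X : A →ₗ[k] A) ∘ₗ coordDeriv e i + ∑ l, coordDeriv e i (X (x l)) • coordDeriv e l := by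
    intro i
    have h := coe_derivation_eq_sum_coord e ⁅coordDerivation e i, X⁆
    have h0 : ∀ l, X (coordDerivation e i (x l)) = 0 := by
      intro l
      rw [hx, coordDerivation_coord]
      split_ifs <;> simp
    have h1 : ∀ l, ⁅coordDerivation e i, X⁆ (x l) = coordDeriv e i (X (x l)) := by
      intro l
      rw [Derivation.commutator_apply, h0, sub_zero]; rfl
    rw [← sub_eq_iff_eq_add']
    rw [hx] at h1
    simp only [h1] at h
    rw [← h]
    ext a
    rfl
  have hterm : ∀ i, ((X : A →ₗ[k] A) ∘ₗ antipode k) ⋆ coordDeriv e i +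
      antipode k ⋆ (coordDeriv e i ∘ₗ (X : A →ₗ[k] A)) =
        (X : A →ₗ[k] A) ∘ₗ (antipode k ⋆ coordDeriv e i) +
          ∑ l, coordDeriv e i (X (x l)) • (antipode k ⋆ coordDeriv e l) := by
    intro i
    rw [hcomm, conv_add, derivation_comp_conv, conv_sum]
    simp only [conv_smul]
    abel
  have hframe : ∀ j, (((X : A →ₗ[k] A) ∘ₗ antipode k) ⋆ (invariantFrame e j : A →ₗ[k] A) +
        antipode k ⋆ ((invariantFrame e j : A →ₗ[k] A) ∘ₗ (X : A →ₗ[k] A))) (x j) =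
      ∑ i, frameMatrix e j i * X (coframeMatrix e i j) +
        ∑ i, ∑ l, coordDeriv e i (X (x l)) * (coframeMatrix e l j * frameMatrix e j i) := by
    intro j
    have h : ((X : A →ₗ[k] A) ∘ₗ antipode k) ⋆ (invariantFrame e j : A →ₗ[k] A) +
        antipode k ⋆ ((invariantFrame e j : A →ₗ[k] A) ∘ₗ (X : A →ₗ[k] A)) =
        ∑ i, frameMatrix e j i • (((X : A →ₗ[k] A) ∘ₗ antipode k) ⋆ coordDeriv e i +
          antipode k ⋆ (coordDeriv e i ∘ₗ (X : A →ₗ[k] A))) := by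
      have hc : (∑ i, frameMatrix e j i • coordDeriv e i) ∘ₗ (X : A →ₗ[k] A) =
          ∑ i, frameMatrix e j i • (coordDeriv e i ∘ₗ (X : A →ₗ[k] A)) := by
        ext a
        simp
      rw [invariantFrame_eq_sum, hc]
      simp only [conv_sum, conv_smul, Finset.sum_add_distrib, smul_add]
    rw [h]
    simp only [hterm, LinearMap.sum_apply, LinearMap.smul_apply, LinearMap.add_apply, smul_eq_mul,
      mul_add, Finset.sum_add_distrib, Finset.mul_sum]
    congr 1
    refine Finset.sum_congr rfl fun i _ => Finset.sum_congr rfl fun l _ => ?_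
    change frameMatrix e j i * (_ * coframeMatrix e l j) = _
    ring
  have hdet : X (coframeMatrix e).det = 0 := by
    refine derivation_unit_eq_zero e X (IsUnit.of_mul_eq_one (frameMatrix e).det ?_)
    rw [← Matrix.det_mul, coframeMatrix_mul_frameMatrix, Matrix.det_one]
  have htr := trace_mul_map_derivation_eq_zero X (frameMatrix e) (coframeMatrix e)
    (frameMatrix_mul_coframeMatrix e) hdet
  have htr' : ∑ j, ∑ i, frameMatrix e j i * X (coframeMatrix e i j) = 0 := by
    rw [← htr]; rfl
  refine (Finset.sum_congr rfl fun j _ => hframe j).trans ?_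
  rw [Finset.sum_add_distrib, htr', zero_add]
  rw [Finset.sum_comm]
  refine Finset.sum_congr rfl fun i _ => ?_
  rw [Finset.sum_comm]
  simp only [← Finset.mul_sum, ← Matrix.mul_apply, coframeMatrix_mul_frameMatrix, Matrix.one_apply]
  simp [hx]

end Frame

/-! ### The modular derivation of a Poisson Hopf algebra -/

section PoissonHopf

variable {k A : Type*} [Field k] [CommRing A] [HopfAlgebra k A] [PoissonAlgebra k A]

local infixl:70 " ⋆ " => conv

/-- The commutator of a left-invariant field `id ⋆ w` with a Hamiltonian derivation: in Sweedler
notation, `D{f, a} = {f₁, a} w(f₂) + {f, D a} + f₁ a₁ w({f₂, a₂})`. -/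
theorem invariant_comp_hamiltonian [IsPoissonHopfAlgebra k A] {ι : Type*} {f : A}
    (r : Coalgebra.Repr k f ι) (w : A →ₗ[k] k)
    (hw : ∀ a b, w (a * b) = counit a * w b + counit b * w a) :
    (LinearMap.id ⋆ scalarMap w) ∘ₗ bracket (k := k) f =
      ∑ i ∈ r.index, algebraMap k A (w (r.right i)) • bracket (k := k) (r.left i) +
        bracket (k := k) f ∘ₗ (LinearMap.id ⋆ scalarMap w) +
        ∑ i ∈ r.index, r.left i • (LinearMap.id ⋆ scalarMap (w ∘ₗ bracket (k := k) (r.right i))) := by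
  ext a
  have hconv : ∀ (g : A →ₗ[k] A) (y : A), (LinearMap.id ⋆ g) y =
      LinearMap.mul' k A (TensorProduct.map LinearMap.id g (comul (R := k) y)) := fun _ _ => rfl
  set s := ℛ k a with hs
  have hf : ∑ i ∈ r.index, counit (R := k) (r.right i) • r.left i = f := by
    have h := conv_apply r LinearMap.id (scalarMap counit)
    rw [conv_scalarMap_counit] at h
    simp only [Algebra.smul_def, mul_comm (algebraMap k A _)]
    exact h.symm
  have ha : ∑ j ∈ s.index, counit (R := k) (s.right j) • s.left j = a := by
    have h := conv_apply s LinearMap.id (scalarMap counit)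
    rw [conv_scalarMap_counit] at h
    simp only [Algebra.smul_def, mul_comm (algebraMap k A _)]
    exact h.symm
  have h1 : (LinearMap.id ⋆ scalarMap w) (bracket (k := k) f a) =
      ∑ i ∈ r.index, ∑ j ∈ s.index,
        (bracket (k := k) (r.left i) (s.left j) * algebraMap k A (w (r.right i * s.right j)) +
          r.left i * s.left j *
            algebraMap k A (w (bracket (k := k) (r.right i) (s.right j)))) := by
    rw [hconv, IsPoissonHopfAlgebra.comul_bracket, ← r.eq, ← s.eq]
    simp only [map_sum, LinearMap.sum_apply, tensorBracket_tmul, map_add, TensorProduct.map_tmul,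
      LinearMap.mul'_apply, LinearMap.id_apply, scalarMap_apply]
    exact Finset.sum_comm
  have h2 : ∀ i, bracket (k := k) (r.left i) a =
      ∑ j ∈ s.index, counit (R := k) (s.right j) • bracket (k := k) (r.left i) (s.left j) := by
    intro i
    conv_lhs => rw [← ha]
    simp
  have h3 : ∀ j, bracket (k := k) f (s.left j) =
      ∑ i ∈ r.index, counit (R := k) (r.right i) • bracket (k := k) (r.left i) (s.left j) := by
    intro j
    conv_lhs => rw [← hf]
    simp
  simp only [LinearMap.comp_apply, LinearMap.add_apply, LinearMap.sum_apply, LinearMap.smul_apply]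
  rw [h1, conv_apply s]
  have h4 : bracket (k := k) f
      (∑ j ∈ s.index, LinearMap.id (R := k) (s.left j) * scalarMap w (s.right j)) =
      ∑ i ∈ r.index, ∑ j ∈ s.index, algebraMap k A (counit (r.right i) * w (s.right j)) *
        bracket (k := k) (r.left i) (s.left j) := by
    rw [Finset.sum_comm, map_sum]
    refine Finset.sum_congr rfl fun j _ => ?_
    rw [scalarMap_apply, LinearMap.id_apply, mul_comm, ← Algebra.smul_def, map_smul, h3,
      Finset.smul_sum]
    refine Finset.sum_congr rfl fun i _ => ?_
    rw [smul_smul, Algebra.smul_def, mul_comm (w _)]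
  rw [h4]
  simp only [h2, conv_apply s, ← Finset.sum_add_distrib, Finset.smul_sum, hw]
  refine Finset.sum_congr rfl fun i _ => Finset.sum_congr rfl fun j _ => ?_
  simp only [Algebra.smul_def, map_add, map_mul, scalarMap_apply, LinearMap.id_apply,
    LinearMap.comp_apply, Algebra.algebraMap_self, RingHom.id_apply]
  ring

/-- The left-invariant form of the modular derivation:
`δ(f) = f₁ ε(δ(f₂)) + S(f₂){f₁, f₃}` in Sweedler notation. -/
theorem modularDerivation_eq_sum [IsPoissonHopfAlgebra k A] {n : ℕ}
    (e : A ≃ₐ[k] MvPolynomial (Fin n) k) {ι : Type*} {f : A} (r : Coalgebra.Repr k f ι) :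
    modularDerivation e f =
      ∑ i ∈ r.index, r.left i * algebraMap k A (counit (modularDerivation e (r.right i))) +
        ∑ i ∈ r.index, (antipode k ⋆ bracket (k := k) (r.left i)) (r.right i) := by
  have hterm : ∀ j, ((bracket (k := k) f ∘ₗ antipode k) ⋆ (invariantFrame e j : A →ₗ[k] A) +
        antipode k ⋆ ((invariantFrame e j : A →ₗ[k] A) ∘ₗ bracket (k := k) f))
          (e.symm (MvPolynomial.X j)) =
      ∑ i ∈ r.index, algebraMap k A (unitTangent e j (r.right i)) *
          (antipode k ⋆ bracket (k := k) (r.left i)) (e.symm (MvPolynomial.X j)) +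
        ∑ i ∈ r.index, r.left i * algebraMap k A
          (unitTangent e j (bracket (k := k) (r.right i) (e.symm (MvPolynomial.X j)))) := by
    intro j
    have h0 : (bracket (k := k) f ∘ₗ antipode k) ⋆ (invariantFrame e j : A →ₗ[k] A) +
        antipode k ⋆ (bracket (k := k) f ∘ₗ (invariantFrame e j : A →ₗ[k] A)) = 0 := by
      have h := derivation_comp_conv (hamiltonian (k := k) f) (antipode k)
        (invariantFrame e j : A →ₗ[k] A)
      rw [antipode_conv_invariantFrame, derivation_comp_scalarMap] at h
      exact h.symm
    have h1 := invariant_comp_hamiltonian r (unitTangent e j) (unitTangent_mul e j)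
    rw [← coe_invariantFrame] at h1
    have h2 : ∀ w : A →ₗ[k] k, antipode k ⋆ (LinearMap.id ⋆ scalarMap w) = scalarMap w := by
      intro w
      rw [← conv_assoc, antipode_conv_id, scalarMap_counit_conv]
    have h3 : (bracket (k := k) f ∘ₗ antipode k) ⋆ (invariantFrame e j : A →ₗ[k] A) +
        antipode k ⋆ ((invariantFrame e j : A →ₗ[k] A) ∘ₗ bracket (k := k) f) =
        ∑ i ∈ r.index, algebraMap k A (unitTangent e j (r.right i)) •
          (antipode k ⋆ bracket (k := k) (r.left i)) +
        ∑ i ∈ r.index, r.left i •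
          scalarMap (unitTangent e j ∘ₗ bracket (k := k) (r.right i)) := by
      rw [h1, conv_add, conv_add, conv_sum, conv_sum]
      simp only [conv_smul, h2]
      rw [add_assoc, add_left_comm, ← add_assoc (_ ⋆ _), h0, zero_add]
    rw [h3]
    simp only [LinearMap.add_apply, LinearMap.sum_apply, LinearMap.smul_apply, smul_eq_mul]
    rfl
  have hdiv := sum_invariantFrame_eq_divergence e (hamiltonian (k := k) f)
  simp only [coe_hamiltonian, hamiltonian_apply] at hdiv
  rw [modularDerivation_apply, ← hdiv, Finset.sum_congr rfl fun j _ => hterm j,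
    Finset.sum_add_distrib, add_comm]
  congr 1
  · rw [Finset.sum_comm]
    refine Finset.sum_congr rfl fun i _ => ?_
    rw [modularDerivation_apply, map_sum, map_sum, Finset.mul_sum]
    rfl
  · rw [Finset.sum_comm]
    refine Finset.sum_congr rfl fun i _ => ?_
    rw [← coe_hamiltonian (k := k) (r.left i),
      antipode_conv_derivation e (hamiltonian (k := k) (r.left i)) (r.right i)]
    exact Finset.sum_congr rfl fun j _ => mul_comm _ _

end PoissonHopf

/-! ### The co-opposite Hopf algebra -/

section CoOpposite

variable {k A : Type*} [Field k] [CommRing A]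

local infixl:70 " ⋆ " => conv

section

variable (k A) [HopfAlgebra k A]

/-- The comultiplication with its two tensor factors exchanged. -/
noncomputable def swapComul : A →ₗ[k] A ⊗[k] A :=
  (TensorProduct.comm k A A).toLinearMap ∘ₗ comul

variable {k A}

theorem swapComul_eq_sum {ι : Type*} {a : A} (r : Coalgebra.Repr k a ι) :
    swapComul k A a = ∑ i ∈ r.index, r.right i ⊗ₜ[k] r.left i := by
  rw [swapComul, LinearMap.comp_apply, ← r.eq]
  simp

theorem swapComul_coassoc :
    (TensorProduct.assoc k A A A).toLinearMap ∘ₗ (swapComul k A).rTensor A ∘ₗ swapComul k A =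
      (swapComul k A).lTensor A ∘ₗ swapComul k A := by
  -- Both sides are images of the two iterated comultiplications under `x ⊗ y ⊗ z ↦ z ⊗ y ⊗ x`.
  let ρ : A ⊗[k] (A ⊗[k] A) →ₗ[k] A ⊗[k] (A ⊗[k] A) :=
    (TensorProduct.assoc k A A A).toLinearMap ∘ₗ
      (TensorProduct.comm k A A).toLinearMap.rTensor A ∘ₗ
        (TensorProduct.comm k A (A ⊗[k] A)).toLinearMap
  have hr : (TensorProduct.assoc k A A A).toLinearMap ∘ₗ (swapComul k A).rTensor A ∘ₗ
      (TensorProduct.comm k A A).toLinearMap = ρ ∘ₗ (comul : A →ₗ[k] A ⊗[k] A).lTensor A := by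
    ext x y
    simp [ρ, swapComul]
  have hl : (swapComul k A).lTensor A ∘ₗ (TensorProduct.comm k A A).toLinearMap =
      ρ ∘ₗ (TensorProduct.assoc k A A A).toLinearMap ∘ₗ
        (comul : A →ₗ[k] A ⊗[k] A).rTensor A := by
    ext x y
    change y ⊗ₜ[k] swapComul k A x = ρ (TensorProduct.assoc k A A A (comul x ⊗ₜ[k] y))
    rw [swapComul_eq_sum (ℛ k x), ← (ℛ k x).eq]
    simp [ρ, TensorProduct.tmul_sum, TensorProduct.sum_tmul]
  ext a
  have h1 := congrArg (fun g : A ⊗[k] A →ₗ[k] _ => g (comul a)) hr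
  have h2 := congrArg (fun g : A ⊗[k] A →ₗ[k] _ => g (comul a)) hl
  have h3 := congrArg (fun g : A →ₗ[k] _ => ρ (g a)) (Coalgebra.coassoc (R := k) (A := A))
  exact h1.trans (h3.symm.trans h2.symm)

theorem rTensor_counit_comp_swapComul :
    (counit : A →ₗ[k] k).rTensor A ∘ₗ swapComul k A = TensorProduct.mk k k A 1 := by
  ext a
  have h := congrArg (TensorProduct.comm k A k) (Coalgebra.lTensor_counit_comul (R := k) a)
  rw [LinearMap.comp_apply, swapComul_eq_sum (ℛ k a)]
  rw [← (ℛ k a).eq, map_sum, map_sum] at h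
  rw [map_sum]
  exact h

theorem lTensor_counit_comp_swapComul :
    (counit : A →ₗ[k] k).lTensor A ∘ₗ swapComul k A = (TensorProduct.mk k A k).flip 1 := by
  ext a
  have h := congrArg (TensorProduct.comm k k A) (Coalgebra.rTensor_counit_comul (R := k) a)
  rw [LinearMap.comp_apply, swapComul_eq_sum (ℛ k a)]
  rw [← (ℛ k a).eq, map_sum, map_sum] at h
  rw [map_sum]
  exact h

theorem swapComul_one : swapComul k A 1 = 1 := by
  simp [swapComul, Algebra.TensorProduct.one_def]

theorem swapComul_mul (a b : A) : swapComul k A (a * b) = swapComul k A a * swapComul k A b := by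
  change TensorProduct.comm k A A (comul (a * b)) = _
  rw [Bialgebra.comul_mul]
  exact map_mul (Algebra.TensorProduct.comm k A A) _ _

theorem mul_antipode_rTensor_swapComul :
    LinearMap.mul' k A ∘ₗ (antipode k).rTensor A ∘ₗ swapComul k A =
      Algebra.linearMap k A ∘ₗ counit := by
  rw [← HopfAlgebra.mul_antipode_lTensor_comul]
  ext a
  simp only [LinearMap.comp_apply, swapComul_eq_sum (ℛ k a)]
  rw [← (ℛ k a).eq]
  simp [mul_comm]

theorem mul_antipode_lTensor_swapComul :
    LinearMap.mul' k A ∘ₗ (antipode k).lTensor A ∘ₗ swapComul k A =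
      Algebra.linearMap k A ∘ₗ counit := by
  rw [← HopfAlgebra.mul_antipode_rTensor_comul]
  ext a
  simp only [LinearMap.comp_apply, swapComul_eq_sum (ℛ k a)]
  rw [← (ℛ k a).eq]
  simp [mul_comm]

theorem swapComul_bracket [PoissonAlgebra k A] [IsPoissonHopfAlgebra k A] (a b : A) :
    swapComul k A (bracket (k := k) a b) =
      tensorBracket k A A (swapComul k A a) (swapComul k A b) := by
  rw [swapComul_eq_sum (ℛ k a), swapComul_eq_sum (ℛ k b)]
  change TensorProduct.comm k A A (comul (bracket (k := k) a b)) = _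
  rw [IsPoissonHopfAlgebra.comul_bracket, ← (ℛ k a).eq, ← (ℛ k b).eq]
  simp [tensorBracket_tmul, add_comm]

end

/-- The co-opposite of a commutative Hopf algebra: the same algebra, counit and antipode, with the
two tensor factors of the comultiplication exchanged. It is the coordinate ring of the opposite
group. Commutativity of the algebra is what allows the antipode to be kept. -/
noncomputable abbrev coOpposite (H : HopfAlgebra k A) : HopfAlgebra k A where
  toAlgebra := H.toAlgebra
  comul := swapComul k A
  counit := H.toCoalgebra.counit
  coassoc := swapComul_coassoc
  rTensor_counit_comp_comul := rTensor_counit_comp_swapComul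
  lTensor_counit_comp_comul := lTensor_counit_comp_swapComul
  counit_one := H.counit_one
  mul_compr₂_counit := H.mul_compr₂_counit
  comul_one := swapComul_one
  mul_compr₂_comul := LinearMap.ext₂ fun a b => swapComul_mul a b
  antipode := H.antipode
  mul_antipode_rTensor_comul := mul_antipode_rTensor_swapComul
  mul_antipode_lTensor_comul := mul_antipode_lTensor_swapComul

/-- A Sweedler representation of `Δ f`, with the factors exchanged, represents the co-opposite
comultiplication. -/
noncomputable def reprCoOpposite (H : HopfAlgebra k A) {ι : Type*} {f : A}
    (r : Coalgebra.Repr k f ι) :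
    @Coalgebra.Repr k A _ _ _ (coOpposite H).toCoalgebra.toCoalgebraStruct f ι :=
  @Coalgebra.Repr.mk k A _ _ _ (coOpposite H).toCoalgebra.toCoalgebraStruct f ι
    r.index r.right r.left (swapComul_eq_sum r).symm

theorem isPoissonHopfAlgebra_coOpposite (H : HopfAlgebra k A) [P : PoissonAlgebra k A]
    [IsPoissonHopfAlgebra k A] : @IsPoissonHopfAlgebra k A _ _ (coOpposite H) P :=
  @IsPoissonHopfAlgebra.mk k A _ _ (coOpposite H) P swapComul_bracket

/-- The right-invariant form of the modular derivation,
`δ(f) = ε(δ(f₁)) f₂ - S(f₂){f₁, f₃}` in Sweedler notation, obtained from the left-invariant one by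
passage to the co-opposite Hopf algebra. -/
theorem modularDerivation_eq_sum_right [H : HopfAlgebra k A] [P : PoissonAlgebra k A]
    [IsPoissonHopfAlgebra k A] {n : ℕ} (e : A ≃ₐ[k] MvPolynomial (Fin n) k) {ι : Type*} {f : A}
    (r : Coalgebra.Repr k f ι) :
    modularDerivation e f =
      ∑ i ∈ r.index, r.right i * algebraMap k A (counit (modularDerivation e (r.left i))) +
        ∑ i ∈ r.index, ∑ j ∈ (ℛ k (r.left i)).index,
          antipode k ((ℛ k (r.left i)).right j) *
            bracket (k := k) (r.right i) ((ℛ k (r.left i)).left j) := by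
  have h := @modularDerivation_eq_sum k A _ _ (coOpposite H) P (isPoissonHopfAlgebra_coOpposite H)
    n e ι f (reprCoOpposite H r)
  refine h.trans ?_
  congr 1
  refine Finset.sum_congr rfl fun i _ => ?_
  exact @conv_apply k A _ _ (coOpposite H) _ _ (reprCoOpposite H (ℛ k (r.left i))) _ _

/-- In Sweedler notation, `2 δ(f) = f₁ ε(δ(f₂)) + ε(δ(f₁)) f₂`: the modular field of a Poisson group
is the mean of the left- and right-invariant fields with the same value at the unit. -/
theorem two_mul_modularDerivation [HopfAlgebra k A] [PoissonAlgebra k A]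
    [IsPoissonHopfAlgebra k A] {n : ℕ} (e : A ≃ₐ[k] MvPolynomial (Fin n) k) {ι : Type*} {f : A}
    (r : Coalgebra.Repr k f ι) :
    modularDerivation e f + modularDerivation e f =
      ∑ i ∈ r.index, r.left i * algebraMap k A (counit (modularDerivation e (r.right i))) +
        ∑ i ∈ r.index, r.right i * algebraMap k A (counit (modularDerivation e (r.left i))) := by
  -- `T (x ⊗ y ⊗ z) = S(y) {x, z}`, evaluated on the iterated comultiplication of `f`.
  let T : A ⊗[k] (A ⊗[k] A) →ₗ[k] A :=
    LinearMap.mul' k A ∘ₗ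
      TensorProduct.map (antipode k) (TensorProduct.lift (bracket (k := k) (A := A))) ∘ₗ
        (TensorProduct.leftComm k A A A).toLinearMap
  have hT : ∀ x y z : A, T (x ⊗ₜ[k] (y ⊗ₜ[k] z)) = antipode k y * bracket (k := k) x z := by
    intro x y z
    simp [T]
  have hl : ∑ i ∈ r.index, (antipode k ⋆ bracket (k := k) (r.left i)) (r.right i) =
      T ((comul : A →ₗ[k] A ⊗[k] A).lTensor A (comul f)) := by
    rw [← r.eq, map_sum, map_sum]
    refine Finset.sum_congr rfl fun i _ => ?_
    rw [conv_apply (ℛ k (r.right i)), LinearMap.lTensor_tmul]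
    conv_rhs => rw [← (ℛ k (r.right i)).eq]
    simp only [TensorProduct.tmul_sum, map_sum, hT]
  have hr : ∑ i ∈ r.index, ∑ j ∈ (ℛ k (r.left i)).index,
      antipode k ((ℛ k (r.left i)).right j) *
        bracket (k := k) (r.right i) ((ℛ k (r.left i)).left j) =
      -T (TensorProduct.assoc k A A A ((comul : A →ₗ[k] A ⊗[k] A).rTensor A (comul f))) := by
    rw [← r.eq, map_sum, map_sum, map_sum, ← Finset.sum_neg_distrib]
    refine Finset.sum_congr rfl fun i _ => ?_
    rw [LinearMap.rTensor_tmul]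
    conv_rhs => rw [← (ℛ k (r.left i)).eq]
    simp only [TensorProduct.sum_tmul, map_sum, TensorProduct.assoc_tmul, hT,
      ← Finset.sum_neg_distrib]
    refine Finset.sum_congr rfl fun j _ => ?_
    rw [bracket_comm ((ℛ k (r.left i)).left j), mul_neg]
  have h := modularDerivation_eq_sum_right e r
  rw [hr, Coalgebra.coassoc_apply, ← hl] at h
  rw [modularDerivation_eq_sum e r] at h ⊢
  conv_lhs => arg 2; rw [h]
  ring

/-- If a character `χ` of `A` kills all brackets and all values of the modular derivation, then the
modular derivation is zero. Geometrically, translating by the point `χ`, at which the Poisson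
tensor vanishes, shows that the modular field vanishes at the unit as well. -/
theorem modularDerivation_eq_zero_of_character [CharZero k] [HopfAlgebra k A] [PoissonAlgebra k A]
    [IsPoissonHopfAlgebra k A] {n : ℕ} (e : A ≃ₐ[k] MvPolynomial (Fin n) k) (χ : A →ₐ[k] k)
    (hχ : ∀ a b, χ (bracket (k := k) a b) = 0) (hmod : ∀ f, χ (modularDerivation e f) = 0) (f : A) :
    modularDerivation e f = 0 := by
  set c : A →ₗ[k] k := counit ∘ₗ modularDerivation e with hc
  let η : A →ₐ[k] A := (Algebra.ofId k A).comp χ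
  have hconv : η.toLinearMap ⋆ scalarMap c = 0 := by
    ext f
    have h := congrArg (algebraMap k A ∘ χ) (modularDerivation_eq_sum e (ℛ k f))
    simp only [Function.comp_apply, hmod, map_add, map_sum, map_mul, map_zero, AlgHom.commutes,
      conv_apply (ℛ k _), hχ, mul_zero, Finset.sum_const_zero, add_zero] at h
    rw [conv_apply (ℛ k f), LinearMap.zero_apply]
    exact h.symm
  have hinv : (η.comp (antipodeAlgHom k A)).toLinearMap ⋆ η.toLinearMap = scalarMap counit :=
    congrArg (fun g : WithConv (A →ₐ[k] A) => g.ofConv.toLinearMap) (inv_mul_cancel (toConv η))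
  have hzero : scalarMap c = 0 := by
    rw [← scalarMap_counit_conv (scalarMap c), ← hinv, conv_assoc, hconv, conv_zero]
  have h0 : ∀ a, algebraMap k A (counit (modularDerivation e a)) = 0 := fun a =>
    congrArg (fun g : A →ₗ[k] A => g a) hzero
  have h2 := two_mul_modularDerivation e (ℛ k f)
  simp only [h0, mul_zero, Finset.sum_const_zero, add_zero] at h2
  have h3 : (2 : k) • modularDerivation e f = 0 := by rw [two_smul, h2]
  exact (smul_eq_zero_iff_right two_ne_zero).1 h3

end CoOpposite

/-! ### Point derivations -/

section PointDerivation

variable {k A : Type*} [Field k] [CommRing A]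

/-- A linear functional `v` is a point derivation at the character `χ` if
`v (a * b) = χ a * v b + χ b * v a`; it is a tangent vector at the point `χ` of the spectrum. -/
def IsPointDerivation [Algebra k A] (χ : A →ₐ[k] k) (v : A →ₗ[k] k) : Prop :=
  ∀ a b, v (a * b) = χ a * v b + χ b * v a

namespace IsPointDerivation

section

variable [Algebra k A] {χ : A →ₐ[k] k} {v w : A →ₗ[k] k}

theorem map_one (hv : IsPointDerivation χ v) : v 1 = 0 := by
  simpa using hv 1 1

theorem map_algebraMap (hv : IsPointDerivation χ v) (r : k) : v (algebraMap k A r) = 0 := by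
  rw [Algebra.algebraMap_eq_smul_one, map_smul, hv.map_one, smul_zero]

theorem ext_of_adjoin_eq_top (hv : IsPointDerivation χ v) (hw : IsPointDerivation χ w) {s : Set A}
    (hs : Algebra.adjoin k s = ⊤) (h : ∀ a ∈ s, v a = w a) : v = w := by
  ext a
  have ha : a ∈ Algebra.adjoin k s := hs ▸ Algebra.mem_top
  induction ha using Algebra.adjoin_induction with
  | mem x hx => exact h x hx
  | algebraMap r => rw [hv.map_algebraMap, hw.map_algebraMap]
  | add x y _ _ hx hy => rw [map_add, map_add, hx, hy]
  | mul x y _ _ hx hy => rw [hv, hw, hx, hy]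

theorem sum_smul {ι : Type*} {s : Finset ι} {c : ι → k} {v : ι → A →ₗ[k] k}
    (hv : ∀ i ∈ s, IsPointDerivation χ (v i)) : IsPointDerivation χ (∑ i ∈ s, c i • v i) := by
  intro a b
  simp only [LinearMap.sum_apply, LinearMap.smul_apply, smul_eq_mul, Finset.mul_sum,
    ← Finset.sum_add_distrib]
  exact Finset.sum_congr rfl fun i hi => by rw [hv i hi]; ring

theorem comp_derivation (D : Derivation k A A) :
    IsPointDerivation χ (χ.toLinearMap ∘ₗ (D : A →ₗ[k] A)) := by
  intro a b
  simp

/-- A derivation that is tangent to the point `χ` acts on the point derivations at `χ`. -/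
theorem comp_derivation_of_tangent (hv : IsPointDerivation χ v) (D : Derivation k A A)
    (hD : ∀ a, χ (D a) = 0) : IsPointDerivation χ (v ∘ₗ (D : A →ₗ[k] A)) := by
  intro a b
  simp [hv _ _, hD]

/-- The expansion of a point derivation in the basis dual to a system of generators. -/
theorem eq_sum_of_dual {n : ℕ} {x : Fin n → A} (hx : Algebra.adjoin k (Set.range x) = ⊤)
    {u : Fin n → A →ₗ[k] k} (hu : ∀ i, IsPointDerivation χ (u i))
    (hdual : ∀ i j, u i (x j) = if i = j then 1 else 0) (hv : IsPointDerivation χ v) :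
    v = ∑ i, v (x i) • u i := by
  refine hv.ext_of_adjoin_eq_top (sum_smul fun i _ => hu i) hx ?_
  rintro _ ⟨j, rfl⟩
  simp [hdual]

end

/-- On an affine group every tangent vector extends to a vector field: translate it to the unit and
spread it out invariantly. -/
theorem exists_derivation [HopfAlgebra k A] {χ : A →ₐ[k] k} {v : A →ₗ[k] k}
    (hv : IsPointDerivation χ v) : ∃ D : Derivation k A A, ∀ a, χ (D a) = v a := by
  let η : A →ₐ[k] A := (Algebra.ofId k A).comp χ
  let q : A →ₐ[k] A := (toConv (AlgHom.id k A) * (toConv η)⁻¹).ofConv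
  have hηη : ∀ a, η (η a) = η a := fun a => by simp [η, Algebra.ofId_apply]
  have hqη : conv q.toLinearMap η.toLinearMap = LinearMap.id :=
    congrArg (fun g : WithConv (A →ₐ[k] A) => g.ofConv.toLinearMap)
      (inv_mul_cancel_right (toConv (AlgHom.id k A)) (toConv η))
  have hηq : η.comp q = (Algebra.ofId k A).comp (Bialgebra.counitAlgHom k A) := by
    have h1 : η.comp q = (toConv η * (toConv η)⁻¹).ofConv := by
      refine (AlgHom.comp_convMul_distrib η (toConv (AlgHom.id k A)) (toConv η)⁻¹).trans ?_
      have h2 : η.comp ((toConv η)⁻¹).ofConv = ((toConv η)⁻¹).ofConv :=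
        AlgHom.ext fun a => hηη _
      rw [h2]
      rfl
    rw [h1, mul_inv_cancel]
    rfl
  have hscalar : ∀ a b, scalarMap v (a * b) = η a * scalarMap v b + η b * scalarMap v a := by
    intro a b
    simp [scalarMap_apply, hv a b, η, Algebra.ofId_apply]
  refine ⟨Derivation.mk' (conv q.toLinearMap (scalarMap v)) fun a b => ?_, fun a => ?_⟩
  · have h := conv_leibniz q η (scalarMap v) hscalar a b
    rwa [hqη] at h
  · have h : η (conv q.toLinearMap (scalarMap v) a) = scalarMap v a := by
      conv_rhs => rw [← scalarMap_counit_conv (scalarMap v)]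
      rw [conv_apply (ℛ k a), conv_apply (ℛ k a), map_sum]
      refine Finset.sum_congr rfl fun i _ => ?_
      rw [map_mul]
      congr 1
      · exact congrArg (fun g : A →ₐ[k] A => g ((ℛ k a).left i)) hηq
      · exact AlgHom.commutes _ _
    have hinj : Function.Injective (algebraMap k A) := by
      have : Nontrivial A := (Bialgebra.counitAlgHom k A).toRingHom.domain_nontrivial
      exact FaithfulSMul.algebraMap_injective k A
    exact hinj h

end IsPointDerivation

end PointDerivation

/-! ### Connected gradings -/

section ConnectedGrading

variable {k A : Type*} [Field k] [CommRing A] [Algebra k A] (𝒜 : ℕ → Submodule k A)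
  [GradedAlgebra 𝒜]

theorem coe_decompose_mul_eq_sum (a b : A) (i : ℕ) :
    (decompose 𝒜 (a * b) i : A) =
      ∑ p ∈ Finset.HasAntidiagonal.antidiagonal i, (decompose 𝒜 a p.1 : A) * decompose 𝒜 b p.2 := by
  rw [decompose_mul, coe_mul_apply_eq_sum_antidiagonal]

/-- The character of a connected graded algebra that sends an element to its degree zero part. -/
theorem exists_character_of_isConnectedGrading [Nontrivial A] (h : IsConnectedGrading 𝒜) :
    ∃ χ : A →ₐ[k] k, ∀ a, algebraMap k A (χ a) = decompose 𝒜 a 0 := by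
  have hinj : Function.Injective (algebraMap k A) := FaithfulSMul.algebraMap_injective k A
  have hex : ∀ a : A, ∃ r : k, algebraMap k A r = GradedRing.projZeroRingHom 𝒜 a := by
    intro a
    have ha : (decompose 𝒜 a 0 : A) ∈ Submodule.span k {(1 : A)} := h ▸ (decompose 𝒜 a 0).2
    obtain ⟨r, hr⟩ := Submodule.mem_span_singleton.1 ha
    exact ⟨r, by rw [Algebra.algebraMap_eq_smul_one, hr]; rfl⟩
  choose c hc using hex
  refine ⟨{ toFun := c
            map_one' := hinj ?_
            map_mul' := fun a b => hinj ?_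
            map_zero' := hinj ?_
            map_add' := fun a b => hinj ?_
            commutes' := fun r => hinj ?_ }, hc⟩
  · rw [hc, map_one, map_one]
  · rw [hc, map_mul, map_mul, hc, hc]
  · rw [hc, map_zero, map_zero]
  · rw [hc, map_add, map_add, hc, hc]
  · rw [hc]
    exact decompose_of_mem_same 𝒜 (SetLike.algebraMap_mem_graded 𝒜 r)

variable {𝒜} {χ : A →ₐ[k] k}

theorem character_eq_zero_of_mem [Nontrivial A]
    (hχ : ∀ a, algebraMap k A (χ a) = decompose 𝒜 a 0) {a : A} {i : ℕ} (ha : a ∈ 𝒜 i)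
    (hi : i ≠ 0) : χ a = 0 := by
  refine FaithfulSMul.algebraMap_injective k A ?_
  rw [hχ, decompose_of_mem_ne 𝒜 ha hi, map_zero]

theorem eq_zero_of_mul_eq_zero_of_character [Nontrivial A]
    (hχ : ∀ a, algebraMap k A (χ a) = decompose 𝒜 a 0) {u a : A} (hu : χ u ≠ 0)
    (h : u * a = 0) : a = 0 := by
  have hcomp : ∀ i, (decompose 𝒜 a i : A) = 0 := by
    intro i
    induction i using Nat.strong_induction_on with
    | _ i ih =>
      have h1 := coe_decompose_mul_eq_sum 𝒜 u a i
      rw [h, decompose_zero, Finset.sum_eq_single (0, i)] at h1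
      · rw [← hχ, ← Algebra.smul_def] at h1
        exact (smul_eq_zero_iff_right hu).1 h1.symm
      · rintro ⟨p, q⟩ hpq hne
        rw [Finset.HasAntidiagonal.mem_antidiagonal] at hpq
        rw [ih q (by grind), mul_zero]
      · intro h2
        exact absurd (by simp) h2
  refine (decompose 𝒜).injective ?_
  rw [decompose_zero]
  ext i
  exact hcomp i

/-- Graded Nakayama: homogeneous elements that span the algebra modulo constants and squares of
the augmentation ideal generate it. -/
theorem adjoin_eq_top_of_span_sup_sq [Nontrivial A]
    (hconn : IsConnectedGrading 𝒜)
    (hχ : ∀ a, algebraMap k A (χ a) = decompose 𝒜 a 0) {ι : Type*} {x : ι → A} {w : ι → ℕ}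
    (hx : ∀ i, x i ∈ 𝒜 (w i))
    (hspan : Submodule.span k (Set.range x) ⊔ (Submodule.span k {(1 : A)} ⊔
      ((RingHom.ker χ) ^ 2).restrictScalars k) = ⊤) :
    Algebra.adjoin k (Set.range x) = ⊤ := by
  set S := Algebra.adjoin k (Set.range x) with hS
  have hmem : ∀ i, ∀ a ∈ 𝒜 i, a ∈ S := by
    intro i
    induction i using Nat.strong_induction_on with
    | _ i ih =>
      intro a ha
      rcases Nat.eq_zero_or_pos i with rfl | hi
      · rw [hconn] at ha
        obtain ⟨r, rfl⟩ := Submodule.mem_span_singleton.1 ha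
        exact S.smul_mem S.one_mem r
      -- The degree `i` part of a product of two elements of the augmentation ideal only involves
      -- components of degree less than `i`.
      have hle : (⊤ : Submodule k A) ≤ S.toSubmodule.comap (GradedAlgebra.proj 𝒜 i) := by
        rw [← hspan]
        refine sup_le (Submodule.span_le.2 ?_) (sup_le (Submodule.span_le.2 ?_) ?_)
        · rintro _ ⟨j, rfl⟩
          change (decompose 𝒜 (x j) i : A) ∈ S
          by_cases hij : w j = i
          · rw [← hij, decompose_of_mem_same 𝒜 (hx j)]
            exact Algebra.subset_adjoin ⟨j, rfl⟩
          · rw [decompose_of_mem_ne 𝒜 (hx j) hij]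
            exact S.zero_mem
        · rintro _ rfl
          change (decompose 𝒜 (1 : A) i : A) ∈ S
          rw [decompose_of_mem_ne 𝒜 SetLike.GradedOne.one_mem hi.ne]
          exact S.zero_mem
        · intro q hq
          rw [Submodule.restrictScalars_mem, pow_two] at hq
          induction hq using Submodule.mul_induction_on' with
          | mem_mul_mem b hb c hc =>
            change (decompose 𝒜 (b * c) i : A) ∈ S
            rw [coe_decompose_mul_eq_sum]
            refine S.sum_mem fun p hp => ?_
            rw [Finset.HasAntidiagonal.mem_antidiagonal] at hp
            have hb0 : (decompose 𝒜 b 0 : A) = 0 := by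
              rw [← hχ, (RingHom.mem_ker).1 hb, map_zero]
            have hc0 : (decompose 𝒜 c 0 : A) = 0 := by
              rw [← hχ, (RingHom.mem_ker).1 hc, map_zero]
            by_cases h1 : p.1 = 0
            · rw [h1, hb0, zero_mul]; exact S.zero_mem
            by_cases h2 : p.2 = 0
            · rw [h2, hc0, mul_zero]; exact S.zero_mem
            exact S.mul_mem (ih _ (by omega) _ (decompose 𝒜 b p.1).2)
              (ih _ (by omega) _ (decompose 𝒜 c p.2).2)
          | add b _ c _ hb hc => exact Submodule.add_mem _ hb hc
      have h := hle (Submodule.mem_top (x := a))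
      change (decompose 𝒜 a i : A) ∈ S at h
      rwa [decompose_of_mem_same 𝒜 ha] at h
  refine eq_top_iff.2 fun a _ => ?_
  classical
  rw [← sum_support_decompose 𝒜 a]
  exact S.sum_mem fun i _ => hmem i _ (decompose 𝒜 a i).2

end ConnectedGrading

/-! ### Homogeneous generators and the polynomial structure -/

section Generators

variable {k A : Type*} [Field k] [CommRing A] [Algebra k A] {𝒜 : ℕ → Submodule k A}
  [GradedAlgebra 𝒜] {χ : A →ₐ[k] k}

/-- A homogeneous basis of the cotangent space `m / m²` at the origin `m = ker χ` gives a system of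
homogeneous generators, together with the dual tangent vectors. -/
theorem exists_homogeneous_generators [Nontrivial A] [Algebra.FiniteType k A]
    (hconn : IsConnectedGrading 𝒜) (hχ : ∀ a, algebraMap k A (χ a) = decompose 𝒜 a 0) :
    ∃ (n : ℕ) (x : Fin n → A) (w : Fin n → ℕ) (v : Fin n → A →ₗ[k] k),
      (∀ i, x i ∈ 𝒜 (w i)) ∧ Algebra.adjoin k (Set.range x) = ⊤ ∧
      (∀ i, IsPointDerivation χ (v i)) ∧ ∀ i j, v i (x j) = if i = j then 1 else 0 := by
  -- `A ⧸ L` is `m / m²`.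
  set L : Submodule k A := Submodule.span k {(1 : A)} ⊔ ((RingHom.ker χ) ^ 2).restrictScalars k
    with hL
  have hmul : ∀ a b, L.mkQ (a * b) = χ a • L.mkQ b + χ b • L.mkQ a := by
    intro a b
    have h1 : (a - algebraMap k A (χ a)) * (b - algebraMap k A (χ b)) ∈ L := by
      refine Submodule.mem_sup_right ?_
      rw [Submodule.restrictScalars_mem, pow_two]
      exact Ideal.mul_mem_mul (by simp [RingHom.mem_ker]) (by simp [RingHom.mem_ker])
    have h2 : algebraMap k A (χ a * χ b) ∈ L :=
      Submodule.mem_sup_left (by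
        rw [Algebra.algebraMap_eq_smul_one]
        exact Submodule.smul_mem _ _ (Submodule.mem_span_singleton_self 1))
    rw [← map_smul, ← map_smul, ← map_add, ← sub_eq_zero, ← map_sub, Submodule.mkQ_apply,
      Submodule.Quotient.mk_eq_zero]
    have h3 := L.sub_mem h1 h2
    convert h3 using 1
    simp only [Algebra.smul_def, map_mul]
    ring
  have hone : ∀ r : k, L.mkQ (algebraMap k A r) = 0 := by
    intro r
    rw [Submodule.mkQ_apply, Submodule.Quotient.mk_eq_zero, Algebra.algebraMap_eq_smul_one]
    exact L.smul_mem _ (Submodule.mem_sup_left (Submodule.mem_span_singleton_self 1))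
  have hfin : Module.Finite k (A ⧸ L) := by
    classical
    obtain ⟨G, hG⟩ := (Algebra.FiniteType.out : (⊤ : Subalgebra k A).FG)
    refine ⟨⟨G.image L.mkQ, eq_top_iff.2 fun y _ => ?_⟩⟩
    obtain ⟨a, rfl⟩ := L.mkQ_surjective y
    have ha : a ∈ Algebra.adjoin k (G : Set A) := hG ▸ Algebra.mem_top
    rw [Finset.coe_image]
    induction ha using Algebra.adjoin_induction with
    | mem x hx => exact Submodule.subset_span ⟨x, hx, rfl⟩
    | algebraMap r => exact (hone r).symm ▸ Submodule.zero_mem _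
    | add x y _ _ hx hy => exact map_add L.mkQ x y ▸ Submodule.add_mem _ (hx trivial) (hy trivial)
    | mul x y _ _ hx hy =>
      rw [hmul]
      exact Submodule.add_mem _ (Submodule.smul_mem _ _ (hy trivial))
        (Submodule.smul_mem _ _ (hx trivial))
  have hspan : Submodule.span k (L.mkQ '' {a | ∃ i, a ∈ 𝒜 i}) = ⊤ := by
    classical
    refine eq_top_iff.2 fun y _ => ?_
    obtain ⟨a, rfl⟩ := L.mkQ_surjective y
    rw [← sum_support_decompose 𝒜 a, map_sum]
    exact Submodule.sum_mem _ fun i _ =>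
      Submodule.subset_span ⟨_, ⟨i, (decompose 𝒜 a i).2⟩, rfl⟩
  obtain ⟨B, hBsub, hBspan, hBli⟩ := exists_linearIndependent k
    (L.mkQ '' {a | ∃ i, a ∈ 𝒜 i})
  let b₀ : Module.Basis B k (A ⧸ L) := Module.Basis.mk hBli (by
    rw [Subtype.range_coe, hBspan, hspan])
  have : Finite B := Module.Finite.finite_basis b₀
  have : Fintype B := Fintype.ofFinite B
  let b := b₀.reindex (Fintype.equivFin B)
  have hb : ∀ j, ∃ a, (∃ i, a ∈ 𝒜 i) ∧ L.mkQ a = b j := by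
    intro j
    have h := hBsub ((Fintype.equivFin B).symm j).2
    simpa [b, b₀] using h
  choose x hx hxb using hb
  choose w hxw using hx
  refine ⟨_, x, w, fun i => b.coord i ∘ₗ L.mkQ, hxw, ?_, fun i a c => ?_, fun i j => ?_⟩
  · refine adjoin_eq_top_of_span_sup_sq hconn hχ hxw ?_
    rw [← hL]
    have h1 : (Submodule.span k (Set.range x)).map L.mkQ = ⊤ := by
      rw [Submodule.map_span, ← Set.range_comp, ← b.span_eq]
      congr 2
      exact funext hxb
    have h2 := congrArg (Submodule.comap L.mkQ) h1
    rwa [Submodule.comap_map_mkQ, Submodule.comap_top, sup_comm] at h2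
  · simp only [LinearMap.comp_apply, hmul, map_add, map_smul, smul_eq_mul]
  · rw [LinearMap.comp_apply, hxb, Module.Basis.coord_apply, Module.Basis.repr_self,
      Finsupp.single_apply]
    simp only [eq_comm]

/-- In characteristic zero a proper ideal of a polynomial ring over a field that is stable under all
partial derivatives is zero. -/
theorem eq_zero_of_pderiv_stable [CharZero k] {n : ℕ} (I : Ideal (MvPolynomial (Fin n) k))
    (hI : I ≠ ⊤) (hstab : ∀ p ∈ I, ∀ j, MvPolynomial.pderiv j p ∈ I) {p : MvPolynomial (Fin n) k}
    (hp : p ∈ I) : p = 0 := by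
  have key : ∀ N : ℕ, ∀ p ∈ I, (∀ m : Fin n →₀ ℕ, N ≤ m.degree → p.coeff m = 0) → p = 0 := by
    intro N
    induction N with
    | zero => exact fun p _ h => MvPolynomial.ext _ _ fun m => by simp [h m (Nat.zero_le _)]
    | succ N ih =>
      intro p hp h
      have hd : ∀ j, MvPolynomial.pderiv j p = 0 := by
        refine fun j => ih _ (hstab p hp j) fun m hm => ?_
        rw [MvPolynomial.coeff_pderiv, h, zero_mul]
        simpa using hm
      have hc : p = MvPolynomial.C (p.coeff 0) := by
        ext m
        rw [MvPolynomial.coeff_C]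
        split_ifs with hm
        · rw [← hm]
        · obtain ⟨j, hj⟩ : ∃ j, m j ≠ 0 := by
            by_contra! h0
            exact hm (Finsupp.ext h0).symm
          have h1 := MvPolynomial.coeff_pderiv (i := j) p (m - Finsupp.single j 1)
          rw [hd, MvPolynomial.coeff_zero, tsub_add_cancel_of_le (by
            rw [Finsupp.single_le_iff]; omega)] at h1
          exact (mul_eq_zero.1 h1.symm).resolve_right (Nat.cast_add_one_ne_zero _)
      by_contra hne
      have hr : p.coeff 0 ≠ 0 := fun h0 => hne (by rw [hc, h0, MvPolynomial.C_0])
      refine hI (Ideal.eq_top_of_isUnit_mem I hp ?_)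
      rw [hc]
      exact (IsUnit.mk0 _ hr).map MvPolynomial.C
  exact key (p.totalDegree + 1) p hp fun m hm =>
    MvPolynomial.coeff_eq_zero_of_totalDegree_lt (by
      rw [Finsupp.degree] at hm
      exact hm)

end Generators

section Polynomial

variable {k A : Type*} [Field k] [CharZero k] [CommRing A] [HopfAlgebra k A]
  {𝒜 : ℕ → Submodule k A} [GradedAlgebra 𝒜] {χ : A →ₐ[k] k}

/-- Generators whose differentials at the origin form a basis of the cotangent space are
algebraically independent: the dual tangent vectors extend to derivations of `A`, so that the ideal
of relations is stable under partial derivatives. -/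
theorem aeval_injective_of_dual [Nontrivial A]
    (hχ : ∀ a, algebraMap k A (χ a) = decompose 𝒜 a 0) {n : ℕ} {x : Fin n → A}
    {v : Fin n → A →ₗ[k] k} (hv : ∀ i, IsPointDerivation χ (v i))
    (hdual : ∀ i j, v i (x j) = if i = j then 1 else 0) :
    Function.Injective (MvPolynomial.aeval x : MvPolynomial (Fin n) k →ₐ[k] A) := by
  choose D hD using fun i => (hv i).exists_derivation
  let M : Matrix (Fin n) (Fin n) A := .of fun i j => D i (x j)
  have hM : χ M.det ≠ 0 := by
    have h : M.map χ = 1 := by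
      refine Matrix.ext fun i j => ?_
      rw [Matrix.map_apply, Matrix.one_apply, ← hdual]
      exact hD i (x j)
    have h1 : χ M.det = (M.map χ).det := AlgHom.map_det χ M
    rw [h1, h, Matrix.det_one]
    exact one_ne_zero
  have hchain : ∀ (E : Derivation k A A) (p : MvPolynomial (Fin n) k),
      E (MvPolynomial.aeval x p) =
        ∑ j, MvPolynomial.aeval x (MvPolynomial.pderiv j p) * E (x j) := by
    intro E p
    induction p using MvPolynomial.induction_on with
    | C r => simp
    | add p q hp hq => simp only [map_add, hp, hq, add_mul, Finset.sum_add_distrib]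
    | mul_X p i hp =>
      simp only [map_mul, MvPolynomial.aeval_X, Derivation.leibniz, hp, smul_eq_mul,
        map_add, add_mul, Finset.sum_add_distrib, Finset.mul_sum, MvPolynomial.pderiv_X,
        Pi.single_apply]
      congr 1
      · simp [Finset.sum_ite_eq]
      · exact Finset.sum_congr rfl fun j _ => by ring
  rw [injective_iff_map_eq_zero]
  intro p hp
  refine eq_zero_of_pderiv_stable
    (RingHom.ker (MvPolynomial.aeval x : MvPolynomial (Fin n) k →ₐ[k] A))
    (RingHom.ker_ne_top _) (fun q hq j => ?_) ((RingHom.mem_ker).2 hp)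
  have hvec : M.mulVec (fun j => MvPolynomial.aeval x (MvPolynomial.pderiv j q)) = 0 := by
    funext i
    have h := hchain (D i) q
    rw [(RingHom.mem_ker).1 hq, map_zero] at h
    exact (Finset.sum_congr rfl fun j _ => mul_comm _ _).trans h.symm
  have hadj := congrArg M.adjugate.mulVec hvec
  rw [Matrix.mulVec_mulVec, Matrix.adjugate_mul, Matrix.smul_mulVec, Matrix.one_mulVec,
    Matrix.mulVec_zero] at hadj
  exact (RingHom.mem_ker).2 (eq_zero_of_mul_eq_zero_of_character hχ hM (congrFun hadj j))

end Polynomial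

/-! ### The modular derivation at the origin -/

section Origin

variable {k A : Type*} [Field k] [CommRing A] [Algebra k A]
  {𝒜 : ℕ → Submodule k A} [GradedAlgebra 𝒜] {χ : A →ₐ[k] k}

/-- A point derivation at the origin that is dual to a homogeneous generator of degree `w i`
vanishes in all other degrees. -/
theorem IsPointDerivation.eq_zero_of_mem [Nontrivial A]
    (hχ : ∀ a, algebraMap k A (χ a) = decompose 𝒜 a 0) {n : ℕ} {x : Fin n → A} {w : Fin n → ℕ} {v : Fin n → A →ₗ[k] k}
    (hx : ∀ i, x i ∈ 𝒜 (w i)) (hgen : Algebra.adjoin k (Set.range x) = ⊤)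
    (hv : ∀ i, IsPointDerivation χ (v i)) (hdual : ∀ i j, v i (x j) = if i = j then 1 else 0)
    (i : Fin n) {a : A} {s : ℕ} (ha : a ∈ 𝒜 s) (hs : s ≠ w i) : v i a = 0 := by
  have hcomp : ∀ (a : A) (p : ℕ), p ≠ 0 → χ (decompose 𝒜 a p) = 0 := fun a p hp =>
    character_eq_zero_of_mem hχ (decompose 𝒜 a p).2 hp
  have hcomp0 : ∀ a : A, χ (decompose 𝒜 a 0) = χ a := fun a => by
    rw [← hχ, AlgHom.commutes]; rfl
  have hproj : IsPointDerivation χ (v i ∘ₗ GradedAlgebra.proj 𝒜 (w i)) := by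
    intro a b
    change v i (decompose 𝒜 (a * b) (w i)) =
      χ a * v i (decompose 𝒜 b (w i)) + χ b * v i (decompose 𝒜 a (w i))
    rw [coe_decompose_mul_eq_sum, map_sum]
    simp only [hv i _ _, Finset.sum_add_distrib]
    congr 1
    · rw [Finset.sum_eq_single (0, w i), hcomp0]
      · rintro ⟨p, q⟩ hpq hne
        rw [Finset.HasAntidiagonal.mem_antidiagonal] at hpq
        rw [hcomp _ _ (by grind), zero_mul]
      · exact fun h => absurd (by simp) h
    · rw [Finset.sum_eq_single (w i, 0), hcomp0]
      · rintro ⟨p, q⟩ hpq hne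
        rw [Finset.HasAntidiagonal.mem_antidiagonal] at hpq
        rw [hcomp _ _ (by grind), zero_mul]
      · exact fun h => absurd (by simp) h
  have heq : v i = v i ∘ₗ GradedAlgebra.proj 𝒜 (w i) := by
    refine (hv i).ext_of_adjoin_eq_top hproj hgen ?_
    rintro _ ⟨j, rfl⟩
    change _ = v i (decompose 𝒜 (x j) (w i))
    by_cases hij : w j = w i
    · rw [← hij, decompose_of_mem_same 𝒜 (hx j)]
    · rw [decompose_of_mem_ne 𝒜 (hx j) hij, map_zero, hdual, if_neg]
      rintro rfl
      exact hij rfl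
  rw [heq]
  change v i (decompose 𝒜 a (w i)) = 0
  rw [decompose_of_mem_ne 𝒜 ha hs, map_zero]

variable [PoissonAlgebra k A]

theorem bracket_algebraMap_left (r : k) (b : A) : bracket (k := k) (algebraMap k A r) b = 0 := by
  rw [bracket_comm b, ← hamiltonian_apply, Derivation.map_algebraMap, neg_zero]

theorem bracket_eq_zero_of_mem_zero {ℬ : ℕ → Submodule k A} (hconn : IsConnectedGrading ℬ) {a : A}
    (ha : a ∈ ℬ 0) (b : A) :
    bracket (k := k) a b = 0 := by
  rw [hconn] at ha
  obtain ⟨r, rfl⟩ := Submodule.mem_span_singleton.1 ha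
  rw [← Algebra.algebraMap_eq_smul_one, bracket_algebraMap_left]

/-- The Poisson tensor vanishes at the origin. -/
theorem character_bracket_eq_zero [Nontrivial A] (hconn : IsConnectedGrading 𝒜)
    (hχ : ∀ a, algebraMap k A (χ a) = decompose 𝒜 a 0) {d : ℕ} (hbr : IsHomogeneousBracket 𝒜 d)
    (a b : A) : χ (bracket (k := k) a b) = 0 := by
  induction a using DirectSum.Decomposition.inductionOn 𝒜 with
  | zero => simp
  | add a a' ha ha' => rw [map_add, LinearMap.add_apply, map_add, ha, ha', add_zero]
  | @homogeneous i a =>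
    rcases Nat.eq_zero_or_pos i with rfl | hi
    · rw [bracket_eq_zero_of_mem_zero hconn a.2, map_zero]
    · induction b using DirectSum.Decomposition.inductionOn 𝒜 with
      | zero => simp
      | add b b' hb hb' => rw [map_add, map_add, hb, hb', add_zero]
      | @homogeneous j b =>
        exact character_eq_zero_of_mem hχ (hbr i j a a.2 b b.2) (by omega)

/-- The modular derivation takes values in the augmentation ideal of the grading. Indeed
`χ (δ f)` is the trace of `{f, -}` on the cotangent space at the origin, and `{f, -}` strictly
raises degrees. -/
theorem character_modularDerivation_eq_zero [Nontrivial A] (hconn : IsConnectedGrading 𝒜)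
    (hχ : ∀ a, algebraMap k A (χ a) = decompose 𝒜 a 0) {d : ℕ} (hbr : IsHomogeneousBracket 𝒜 d)
    {n : ℕ} {x : Fin n → A} {w : Fin n → ℕ} {v : Fin n → A →ₗ[k] k}
    (hx : ∀ i, x i ∈ 𝒜 (w i)) (hgen : Algebra.adjoin k (Set.range x) = ⊤)
    (hv : ∀ i, IsPointDerivation χ (v i)) (hdual : ∀ i j, v i (x j) = if i = j then 1 else 0)
    {m : ℕ} (e : A ≃ₐ[k] MvPolynomial (Fin m) k) (f : A) : χ (modularDerivation e f) = 0 := by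
  have hdiag : ∀ i f, v i (bracket (k := k) f (x i)) = 0 := by
    intro i f
    induction f using DirectSum.Decomposition.inductionOn 𝒜 with
    | zero => simp
    | add f f' hf hf' => rw [map_add, LinearMap.add_apply, map_add, hf, hf', add_zero]
    | @homogeneous j f =>
      rcases Nat.eq_zero_or_pos j with rfl | hj
      · rw [bracket_eq_zero_of_mem_zero hconn f.2, map_zero]
      · exact IsPointDerivation.eq_zero_of_mem hχ hx hgen hv hdual i
          (hbr j (w i) f f.2 (x i) (hx i)) (by omega)
  -- Change of basis for the trace, from the coordinates of `e` to the homogeneous generators.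
  let u : Fin m → A →ₗ[k] k := fun j => χ.toLinearMap ∘ₗ (coordDerivation e j : A →ₗ[k] A)
  have hu : ∀ j, IsPointDerivation χ (u j) := fun j =>
    IsPointDerivation.comp_derivation (coordDerivation e j)
  have hudual : ∀ i j, u i (e.symm (MvPolynomial.X j)) = if i = j then 1 else 0 := by
    intro i j
    change χ (coordDerivation e i _) = _
    rw [coordDerivation_coord]
    split_ifs <;> simp
  have hX : ∀ a, χ (hamiltonian (k := k) f a) = 0 := fun a =>
    character_bracket_eq_zero hconn hχ hbr f a
  have htrace : χ (modularDerivation e f) = ∑ i, v i (bracket (k := k) f (x i)) := by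
    rw [modularDerivation_apply, map_sum]
    have h1 : ∀ j, χ (coordDeriv e j (bracket (k := k) f (e.symm (MvPolynomial.X j)))) =
        ∑ i, u j (x i) * v i (bracket (k := k) f (e.symm (MvPolynomial.X j))) := by
      intro j
      have h := congrArg (fun g : A →ₗ[k] k =>
        g (bracket (k := k) f (e.symm (MvPolynomial.X j)))) ((hu j).eq_sum_of_dual hgen hv hdual)
      simp only [LinearMap.sum_apply, LinearMap.smul_apply, smul_eq_mul] at h
      exact h
    rw [Finset.sum_congr rfl fun j _ => h1 j, Finset.sum_comm]
    refine Finset.sum_congr rfl fun i _ => ?_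
    have h := congrArg (fun g : A →ₗ[k] k => g (x i))
      (((hv i).comp_derivation_of_tangent (hamiltonian (k := k) f) hX).eq_sum_of_dual
        (adjoin_range_coord e) hu hudual)
    simp only [LinearMap.comp_apply, LinearMap.sum_apply, LinearMap.smul_apply, smul_eq_mul,
      coe_hamiltonian] at h
    rw [h]
    exact Finset.sum_congr rfl fun j _ => mul_comm _ _
  exact htrace.trans (Finset.sum_eq_zero fun i _ => hdiag i f)

end Origin

/-! ### Connected graded Poisson Hopf algebras are unimodular -/

theorem theorem0p1 {k A : Type*} [Field k] [IsAlgClosed k] [CharZero k]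
    [CommRing A] [HopfAlgebra k A] [PoissonAlgebra k A] [IsPoissonHopfAlgebra k A]
    [Algebra.FiniteType k A]
    (𝒜 : ℕ → Submodule k A) [GradedAlgebra 𝒜]
    (hconn : PoissonAlgebra.IsConnectedGrading 𝒜)
    (d : ℕ) (hbr : PoissonAlgebra.IsHomogeneousBracket 𝒜 d) :
    PoissonAlgebra.IsUnimodularPolynomial k A ∧
      ∀ (n : ℕ) (e : A ≃ₐ[k] MvPolynomial (Fin n) k) (f : A),
        PoissonAlgebra.modularDerivation e f = 0 := by
  have : Nontrivial A := (Bialgebra.counitAlgHom k A).toRingHom.domain_nontrivial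
  obtain ⟨χ, hχ⟩ := exists_character_of_isConnectedGrading 𝒜 hconn
  obtain ⟨n, x, w, v, hx, hgen, hv, hdual⟩ := exists_homogeneous_generators hconn hχ
  have hzero : ∀ (n : ℕ) (e : A ≃ₐ[k] MvPolynomial (Fin n) k) (f : A),
      modularDerivation e f = 0 := fun _ e =>
    modularDerivation_eq_zero_of_character e χ (character_bracket_eq_zero hconn hχ hbr)
      (character_modularDerivation_eq_zero hconn hχ hbr hx hgen hv hdual e)
  refine ⟨⟨⟨n, ⟨(AlgEquiv.ofBijective (MvPolynomial.aeval x)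
    ⟨aeval_injective_of_dual hχ hv hdual, ?_⟩).symm⟩⟩, fun m e => ⟨1, fun f => ?_⟩⟩, hzero⟩
  · rw [← AlgHom.range_eq_top, ← Algebra.adjoin_range_eq_range_aeval, hgen]
  · rw [hzero, Units.val_one, ← map_one (algebraMap k A), bracket_algebraMap_left, mul_zero]
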